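/- Let $T>0$ and $\lambda>0$. Write $v(p)=p(1+|p|^2)^{-1/2}$ for $p\in\mathbb R^3$, and let $L^1_{kin}(\mathbb R^6)$ be the set of $g\in L^1(\mathbb R^3_x\times\mathbb R^3_p)$ with $g\ge 0$ and $\iint\sqrt{1+|p|^2}\,g\,dx\,dp<\infty$. Let $f_0\in L^1_{kin}\cap L^\infty(\mathbb R^6)$ and $E_0,B_0\in[L^2(\mathbb R^3)]^3$, and let $(f,E,B)$ be a weak solution on $[0,T[$ of the relativistic Vlasov--Maxwell system $$\partial_t f+v\cdot\nabla_x f+(E+v\times B)\cdot\nabla_p f=0,\qquad \partial_tE-\nabla\times B=-4\pi j,\qquad \partial_tB+\nabla\times E=0,\qquad \nabla\cdot E=4\pi\rho,\quad \nabla\cdot B=0,$$ $$\rho(t,x)=\int_{\mathbb R^3} f(t,x,p)\,dp,\qquad j(t,x)=\int_{\mathbb R^3} v(p)f(t,x,p)\,dp,$$ with initial data $(f_0,E_0,B_0)$. That is, $f\in L^\infty([0,T[;L^1_{kin}\cap L^\infty(\mathbb R^6))$ (in particular $\iint\sqrt{1+|p|^2}f(t)\,dx\,dp$ and $\|f(t)\|_{L^\infty}$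 are essentially bounded in $t$), $E,B\in[L^\infty([0,T[;L^2(\mathbb R^3))]^3$, and the equations hold in the sense of distributions with smooth test functions compactly supported in $[0,T[\times\mathbb R^6$ (respectively $[0,T[\times\mathbb R^3$), the initial data entering through the boundary term at $t=0$; for the Vlasov equation this means $$\int_0^T\!\!\int_{\mathbb R^6} f\,\big[\partial_t\varphi+v\cdot\nabla_x\varphi+(E+v\times B)\cdot\nabla_p\varphi\big]\,dx\,dp\,dt=-\int_{\mathbb R^6}f_0(x,p)\,\varphi(0,x,p)\,dx\,dp$$ for all such $\varphi$. Suppose that $E,B\in[L^1(]0,T[;BV_{loc}(\mathbb R^3))]^3$, i.e. for each component $u$ of $E$ and $B$ and every $R>0$ the norm $\|u(t)\|_{L^1(B_R)}+|\nabla u(t)|(B_R)$ is integrable over $t\in{}]0,T[$, and that $$\rho_\lambda(t,x):=\int_{\mathbb R^3}|p|^\lambda f(t,x,p)\,dp$$ belongs to $L^\infty(]0,T[;L^2(\mathbb R^3))$. Then $E\cdot j\in L^1(]0,T[\times\mathbb R^3)$, and for almost all $t\in[0,T[$ $$\int_{\mathbb R^3\times\mathbb R^3}\sqrt{1+|p|^2}\,f(t,x,p)\,dx\,dp=\int_{\mathbb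 R^3\times\mathbb R^3}\sqrt{1+|p|^2}\,f_0(x,p)\,dx\,dp+\int_0^t\!\int_{\mathbb R^3}E\cdot j\,dx\,ds .$$ -/

import Mathlib

open MeasureTheory Set
open scoped ENNReal NNReal ContDiff

noncomputable section

namespace RVM

/-- Three-dimensional Euclidean space (positions, momenta, field values). -/
abbrev V3 : Type := EuclideanSpace ℝ (Fin 3)

/-- The `i`-th standard unit vector. -/
def e (i : Fin 3) : V3 := EuclideanSpace.single i (1 : ℝ)

/-- The vector product on `V3`. -/
def cross (a b : V3) : V3 := WithLp.toLp 2 (crossProduct (WithLp.ofLp a) (WithLp.ofLp b))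

/-- The particle energy `√(1 + |p|²)`. -/
def energy (p : V3) : ℝ := Real.sqrt (1 + ‖p‖ ^ 2)

/-- The relativistic velocity `v = p (1 + |p|²)^{-1/2}`. -/
def vel (p : V3) : V3 := (energy p)⁻¹ • p

/-- The Lorentz force `K = E + v × B`. -/
def lorentz (E B : ℝ → V3 → V3) (t : ℝ) (x p : V3) : V3 := E t x + cross (vel p) (B t x)

/-- The charge density `ρ = ∫ f dp`; here `f t (x, p)` is the distribution function. -/
def rho (f : ℝ → V3 × V3 → ℝ) (t : ℝ) (x : V3) : ℝ := ∫ p : V3, f t (x, p)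

/-- The current density `j = ∫ v f dp`. -/
def current (f : ℝ → V3 × V3 → ℝ) (t : ℝ) (x : V3) : V3 := ∫ p : V3, f t (x, p) • vel p

/-- The moment `ρ_lam = ∫ |p|^lam f dp` of a nonnegative `f`, with values in `[0, ∞]`, so that it
is infinite (and not zero) where the integral diverges. -/
def rhoMoment (lam : ℝ) (f : ℝ → V3 × V3 → ℝ) (t : ℝ) (x : V3) : ℝ≥0∞ :=
  ∫⁻ p : V3, ENNReal.ofReal (‖p‖ ^ lam * f t (x, p))

/-- `L¹_kin(ℝ⁶)`: nonnegative integrable functions with finite kinetic energy. -/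
structure MemL1Kin (g : V3 × V3 → ℝ) : Prop where
  integrable : Integrable g
  nonneg : ∀ᵐ z, 0 ≤ g z
  energy_integrable : Integrable (fun z : V3 × V3 => energy z.2 * g z)

/-- `f ∈ L^∞([0,T[; L¹_kin ∩ L^∞(ℝ⁶))`. As `1 ≤ √(1+|p|²)`, the bound on the kinetic energy also
bounds the `L¹` norm. -/
structure MemLinftyKin (T : ℝ) (f : ℝ → V3 × V3 → ℝ) : Prop where
  measurable : AEStronglyMeasurable (fun z : ℝ × V3 × V3 => f z.1 z.2)
    ((volume.restrict (Ioo 0 T)).prod volume)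
  mem : ∀ᵐ t ∂(volume.restrict (Ioo 0 T)), MemL1Kin (f t) ∧ MemLp (f t) ⊤
  bound : ∃ C : ℝ≥0, ∀ᵐ t ∂(volume.restrict (Ioo 0 T)),
    ∫ z : V3 × V3, energy z.2 * f t z ≤ C ∧ eLpNorm (f t) ⊤ volume ≤ C

/-- `u ∈ [L^∞([0,T[; L²(ℝ³))]³`. -/
structure MemLinftyL2 (T : ℝ) (u : ℝ → V3 → V3) : Prop where
  measurable : AEStronglyMeasurable (fun z : ℝ × V3 => u z.1 z.2)
    ((volume.restrict (Ioo 0 T)).prod volume)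
  bound : ∃ C : ℝ≥0, ∀ᵐ t ∂(volume.restrict (Ioo 0 T)), eLpNorm (u t) 2 volume ≤ C

/-- Test functions: smooth with compact support in `[0,T[ × X`, written as restrictions of
smooth compactly supported functions on `ℝ × X` that vanish near and after time `T`. They need not
vanish at time `0`. -/
structure IsTest {X Y : Type*} [NormedAddCommGroup X] [NormedSpace ℝ X]
    [NormedAddCommGroup Y] [NormedSpace ℝ Y] (T : ℝ) (φ : ℝ × X → Y) : Prop where
  smooth : ContDiff ℝ ∞ φ
  compact : HasCompactSupport φ
  support : tsupport φ ⊆ Iio T ×ˢ univ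

/-- The time derivative of a function of `(t, x)`. -/
def dt {Y : Type*} [NormedAddCommGroup Y] [NormedSpace ℝ Y] (φ : ℝ × V3 → Y) (t : ℝ) (x : V3) : Y :=
  fderiv ℝ φ (t, x) (1, 0)

/-- The partial derivative in the `i`-th space direction of a function of `(t, x)`. -/
def dx {Y : Type*} [NormedAddCommGroup Y] [NormedSpace ℝ Y] (i : Fin 3) (φ : ℝ × V3 → Y)
    (t : ℝ) (x : V3) : Y :=
  fderiv ℝ φ (t, x) (0, e i)

/-- The spatial gradient. -/
def grad (φ : ℝ × V3 → ℝ) (t : ℝ) (x : V3) : V3 :=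
  WithLp.toLp 2 (fun i => dx i φ t x)

/-- The spatial curl. -/
def curl (Φ : ℝ × V3 → V3) (t : ℝ) (x : V3) : V3 :=
  !₂[dx 1 Φ t x 2 - dx 2 Φ t x 1, dx 2 Φ t x 0 - dx 0 Φ t x 2, dx 0 Φ t x 1 - dx 1 Φ t x 0]

/-- `∂ₜ f + v·∇ₓ f + K·∇ₚ f = 0`, `f(0) = f₀` in the sense of distributions on `[0,T[ × ℝ⁶`. The
directional derivatives are `∂ₜφ`, `v·∇ₓφ` and `K·∇ₚφ`. -/
def VlasovWeak (T : ℝ) (f₀ : V3 × V3 → ℝ) (f : ℝ → V3 × V3 → ℝ) (E B : ℝ → V3 → V3) : Prop :=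
  ∀ φ : ℝ × V3 × V3 → ℝ, IsTest T φ →
    ∫ t in Ioo 0 T, ∫ z : V3 × V3, f t z *
        (fderiv ℝ φ (t, z) (1, 0, 0) + fderiv ℝ φ (t, z) (0, vel z.2, 0)
          + fderiv ℝ φ (t, z) (0, 0, lorentz E B t z.1 z.2))
      = - ∫ z : V3 × V3, f₀ z * φ (0, z)

/-- `∂ₜ E - ∇ × B = -4π j`, `E(0) = E₀` in the sense of distributions. -/
def AmpereWeak (T : ℝ) (E₀ : V3 → V3) (f : ℝ → V3 × V3 → ℝ) (E B : ℝ → V3 → V3) : Prop :=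
  ∀ Φ : ℝ × V3 → V3, IsTest T Φ →
    ∫ t in Ioo 0 T, ∫ x : V3, (inner ℝ (E t x) (dt Φ t x) + inner ℝ (B t x) (curl Φ t x)
        - 4 * Real.pi * inner ℝ (current f t x) (Φ (t, x)))
      = - ∫ x : V3, inner ℝ (E₀ x) (Φ (0, x))

/-- `∂ₜ B + ∇ × E = 0`, `B(0) = B₀` in the sense of distributions. -/
def FaradayWeak (T : ℝ) (B₀ : V3 → V3) (E B : ℝ → V3 → V3) : Prop :=
  ∀ Φ : ℝ × V3 → V3, IsTest T Φ →
    ∫ t in Ioo 0 T, ∫ x : V3, (inner ℝ (B t x) (dt Φ t x) - inner ℝ (E t x) (curl Φ t x))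
      = - ∫ x : V3, inner ℝ (B₀ x) (Φ (0, x))

/-- `∇ · E = 4π ρ` in the sense of distributions. -/
def GaussElectricWeak (T : ℝ) (f : ℝ → V3 × V3 → ℝ) (E : ℝ → V3 → V3) : Prop :=
  ∀ φ : ℝ × V3 → ℝ, IsTest T φ →
    ∫ t in Ioo 0 T, ∫ x : V3, inner ℝ (E t x) (grad φ t x)
      = - ∫ t in Ioo 0 T, ∫ x : V3, 4 * Real.pi * rho f t x * φ (t, x)

/-- `∇ · B = 0` in the sense of distributions. -/
def GaussMagneticWeak (T : ℝ) (B : ℝ → V3 → V3) : Prop :=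
  ∀ φ : ℝ × V3 → ℝ, IsTest T φ →
    ∫ t in Ioo 0 T, ∫ x : V3, inner ℝ (B t x) (grad φ t x) = 0

/-- `(f, E, B)` is a weak solution on `[0,T[` of the relativistic Vlasov-Maxwell system with
initial data `(f₀, E₀, B₀)`. -/
structure IsWeakSolution (T : ℝ) (f₀ : V3 × V3 → ℝ) (E₀ B₀ : V3 → V3)
    (f : ℝ → V3 × V3 → ℝ) (E B : ℝ → V3 → V3) : Prop where
  f_mem : MemLinftyKin T f
  E_mem : MemLinftyL2 T E
  B_mem : MemLinftyL2 T B
  vlasov : VlasovWeak T f₀ f E B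
  ampere : AmpereWeak T E₀ f E B
  faraday : FaradayWeak T B₀ E B
  gaussElectric : GaussElectricWeak T f E
  gaussMagnetic : GaussMagneticWeak T B

/-- The divergence of a vector field on `ℝ³`. -/
def divergence (φ : V3 → V3) (x : V3) : ℝ := ∑ i : Fin 3, fderiv ℝ φ x (e i) i

/-- The variation of `u` in the open set `Ω`: the supremum of `∫_Ω u div φ` over smooth vector
fields `φ` with compact support in `Ω` and `|φ| ≤ 1`; it is the total mass of `|∇u|` on `Ω`. -/
def variation (u : V3 → ℝ) (Ω : Set V3) : ℝ≥0∞ :=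
  ⨆ (φ : V3 → V3) (_ : ContDiff ℝ ∞ φ ∧ HasCompactSupport φ ∧ tsupport φ ⊆ Ω ∧ ∀ x, ‖φ x‖ ≤ 1),
    ENNReal.ofReal (∫ x in Ω, u x * divergence φ x)

/-- `u ∈ BV_loc(ℝ³)`. -/
structure MemBVLoc (u : V3 → ℝ) : Prop where
  locallyIntegrable : LocallyIntegrable u
  variation_lt_top : ∀ R : ℝ, 0 < R → variation u (Metric.ball 0 R) < ⊤

/-- `u ∈ L¹(]0,T[; BV_loc(ℝ³))`: the norm of `u(t)` in `BV(B_R)` is integrable in time for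
every radius `R`. -/
structure MemL1BVLoc (T : ℝ) (u : ℝ → V3 → ℝ) : Prop where
  measurable : AEStronglyMeasurable (fun z : ℝ × V3 => u z.1 z.2)
    ((volume.restrict (Ioo 0 T)).prod volume)
  mem : ∀ᵐ t ∂(volume.restrict (Ioo 0 T)), MemBVLoc (u t)
  norm_integrable : ∀ R : ℝ, 0 < R →
    ∫⁻ t in Ioo 0 T,
      (eLpNorm (u t) 1 (volume.restrict (Metric.ball 0 R)) + variation (u t) (Metric.ball 0 R)) < ⊤

end RVM

end

namespace RVM

/-! Formally, multiply the Vlasov equation by `energy p` and integrate. Since `∇ energy = vel` and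
`vel p` is orthogonal to `vel p × B`, the force term becomes `E · j` and the transport term
integrates to zero. The energy is not compactly supported, so the test function is `θ(t) χ(x/n)
energy(p) χ(p/n)` and one lets `n → ∞`.

The limit is taken by dominated convergence. The derivatives of the cutoffs and of the truncated
energies are bounded uniformly in `n`, so the integrand is dominated by a multiple of `(energy + |E|
+ |B|) f` (`exists_vlasovIntegrand_bound`).

The crux is that `|E| f` and `|B| f` are integrable (`integrable_field_mul`). Where `|p| < 1`, `f`
is bounded on a set of finite measure in `p`, so `f ∈ L¹` and a square integrable field suffice.
Where `|p| ≥ 1`, `f ≤ |p|^lam f`, whose `p`-integral is in `L²` and pairs with the field.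

The limit says that the kinetic energy has weak time derivative `∫ E · j dx` and the right initial
value (`weak_energy_balance`). A one-dimensional argument turns this into the integrated identity at
almost every time (`ae_eq_add_integral_of_weak_deriv`). -/

/-! ### Energy, velocity and Lorentz force -/

lemma one_le_energy (p : V3) : 1 ≤ energy p := by
  rw [energy, Real.one_le_sqrt]; nlinarith [sq_nonneg ‖p‖]

lemma energy_pos (p : V3) : 0 < energy p := lt_of_lt_of_le one_pos (one_le_energy p)

lemma contDiff_energy : ContDiff ℝ ∞ energy := by
  unfold energy
  exact (contDiff_const.add (contDiff_norm_sq ℝ)).sqrt (fun p => by positivity)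

lemma continuous_energy : Continuous energy := contDiff_energy.continuous

lemma norm_le_energy (p : V3) : ‖p‖ ≤ energy p :=
  Real.le_sqrt_of_sq_le (by linarith)

lemma energy_le (p : V3) : energy p ≤ 1 + ‖p‖ :=
  Real.sqrt_le_iff.2 ⟨by positivity, by nlinarith [norm_nonneg p]⟩

lemma continuous_vel : Continuous vel :=
  (continuous_energy.inv₀ fun p => (energy_pos p).ne').smul continuous_id

lemma norm_vel_le_one (p : V3) : ‖vel p‖ ≤ 1 := by
  rw [vel, norm_smul, norm_inv, Real.norm_of_nonneg (energy_pos p).le,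
    inv_mul_le_one₀ (energy_pos p)]
  exact norm_le_energy p

lemma fderiv_energy_apply (p w : V3) : fderiv ℝ energy p w = inner ℝ (vel p) w := by
  have h : HasFDerivAt (fun q : V3 => 1 + ‖q‖ ^ 2) (2 • innerSL ℝ p) p :=
    ((hasStrictFDerivAt_norm_sq p).hasFDerivAt).const_add 1
  have h' := h.sqrt (by positivity)
  have : HasFDerivAt energy _ p := h'
  rw [this.fderiv]
  simp only [vel, smul_apply, innerSL_apply_apply, smul_eq_mul,
    real_inner_smul_left, nsmul_eq_mul]
  rw [show √(1 + ‖p‖ ^ 2) = energy p from rfl]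
  have := (energy_pos p).ne'
  push_cast
  field_simp

lemma norm_fderiv_energy_le (p : V3) : ‖fderiv ℝ energy p‖ ≤ 1 := by
  refine ContinuousLinearMap.opNorm_le_bound _ zero_le_one fun w => ?_
  rw [fderiv_energy_apply]
  exact (norm_inner_le_norm _ _).trans (by gcongr; exact norm_vel_le_one p)

lemma inner_cross_self_left (a b : V3) : inner ℝ a (cross a b) = 0 := by
  simp [cross, PiLp.inner_apply, Fin.sum_univ_three, cross_apply]; ring

lemma norm_cross_le (a b : V3) : ‖cross a b‖ ≤ ‖a‖ * ‖b‖ := by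
  rw [← sq_le_sq₀ (norm_nonneg _) (by positivity), mul_pow]
  simp only [cross, EuclideanSpace.norm_sq_eq, Fin.sum_univ_three, cross_apply,
    Real.norm_eq_abs, sq_abs]
  simp
  -- Lagrange's identity: the defect is exactly the square of the inner product.
  nlinarith [sq_nonneg (a 0 * b 0 + a 1 * b 1 + a 2 * b 2)]

lemma continuous_cross : Continuous fun q : V3 × V3 => cross q.1 q.2 := by
  unfold cross
  refine (PiLp.continuous_toLp 2 _).comp (continuous_pi fun i => ?_)
  fin_cases i <;> simp [cross_apply] <;> fun_prop

lemma norm_lorentz_le (E B : ℝ → V3 → V3) (t : ℝ) (x p : V3) :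
    ‖lorentz E B t x p‖ ≤ ‖E t x‖ + ‖B t x‖ := by
  refine (norm_add_le _ _).trans (add_le_add_right ?_ _)
  refine (norm_cross_le _ _).trans ?_
  exact mul_le_of_le_one_left (norm_nonneg _) (norm_vel_le_one p)

/-- The magnetic force does no work. -/
lemma inner_vel_lorentz (E B : ℝ → V3 → V3) (t : ℝ) (x p : V3) :
    inner ℝ (vel p) (lorentz E B t x p) = inner ℝ (E t x) (vel p) := by
  rw [lorentz, inner_add_right, inner_cross_self_left, add_zero, real_inner_comm]

/-! ### Cutoffs and the truncated energy -/

/-- A smooth cutoff equal to `1` on the unit ball and supported in the ball of radius `2`. -/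
noncomputable def bump : ContDiffBump (0 : V3) := ⟨1, 2, one_pos, one_lt_two⟩

/-- The smooth cutoff at radius `n + 1`. -/
noncomputable def cutoff (n : ℕ) (x : V3) : ℝ := bump (((n : ℝ) + 1)⁻¹ • x)

lemma contDiff_cutoff (n : ℕ) : ContDiff ℝ ∞ (cutoff n) :=
  bump.contDiff.comp (contDiff_const_smul _)

lemma cutoff_nonneg (n : ℕ) (x : V3) : 0 ≤ cutoff n x := bump.nonneg

lemma cutoff_le_one (n : ℕ) (x : V3) : cutoff n x ≤ 1 := bump.le_one

lemma norm_scaled (n : ℕ) (x : V3) : ‖((n : ℝ) + 1)⁻¹ • x‖ = ‖x‖ / (n + 1) := by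
  rw [norm_smul, norm_inv, Real.norm_of_nonneg (by positivity)]; field_simp

lemma cutoff_eq_one {n : ℕ} {x : V3} (h : ‖x‖ ≤ n + 1) : cutoff n x = 1 := by
  refine bump.one_of_mem_closedBall ?_
  rw [mem_closedBall_zero_iff, norm_scaled]
  exact (div_le_one (by positivity)).2 h

lemma cutoff_eq_zero {n : ℕ} {x : V3} (h : 2 * ((n : ℝ) + 1) ≤ ‖x‖) : cutoff n x = 0 := by
  refine bump.zero_of_le_dist ?_
  rw [dist_zero_right, norm_scaled]
  exact (le_div_iff₀ (by positivity)).2 h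

lemma hasCompactSupport_cutoff (n : ℕ) : HasCompactSupport (cutoff n) := by
  refine HasCompactSupport.of_support_subset_isCompact
    (isCompact_closedBall (0 : V3) (2 * ((n : ℝ) + 1))) fun x hx => ?_
  rw [mem_closedBall_zero_iff]
  by_contra! h
  exact hx (cutoff_eq_zero h.le)

lemma fderiv_cutoff_eq_zero_of_lt {n : ℕ} {x : V3} (h : ‖x‖ < n + 1) :
    fderiv ℝ (cutoff n) x = 0 := by
  have : cutoff n =ᶠ[nhds x] fun _ => (1 : ℝ) := by
    filter_upwards [(isOpen_lt continuous_norm continuous_const).mem_nhds h] with y hy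
    exact cutoff_eq_one (le_of_lt hy)
  rw [this.fderiv_eq]; simp

lemma fderiv_cutoff_eq_zero_of_gt {n : ℕ} {x : V3} (h : 2 * ((n : ℝ) + 1) < ‖x‖) :
    fderiv ℝ (cutoff n) x = 0 := by
  have : cutoff n =ᶠ[nhds x] fun _ => (0 : ℝ) := by
    filter_upwards [(isOpen_lt continuous_const continuous_norm).mem_nhds h] with y hy
    exact cutoff_eq_zero (le_of_lt hy)
  rw [this.fderiv_eq]; simp

/-- Chain rule for the rescaling. The decay in `n` is what later offsets the linear growth of the
energy. -/
lemma exists_norm_fderiv_cutoff_le :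
    ∃ K : ℝ, 0 ≤ K ∧ ∀ n x, ‖fderiv ℝ (cutoff n) x‖ ≤ K / (n + 1) := by
  have hb : ContDiff ℝ ∞ (bump : V3 → ℝ) := bump.contDiff
  obtain ⟨K, hK⟩ := (hb.continuous_fderiv (by simp)).bounded_above_of_compact_support
    (bump.hasCompactSupport.fderiv (𝕜 := ℝ))
  refine ⟨K, (norm_nonneg _).trans (hK 0), fun n x => ?_⟩
  have h : HasFDerivAt (cutoff n) ((fderiv ℝ bump (((n : ℝ) + 1)⁻¹ • x)).comp
      (((n : ℝ) + 1)⁻¹ • ContinuousLinearMap.id ℝ V3)) x :=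
    HasFDerivAt.comp x ((hb.differentiable (by simp)) _).hasFDerivAt
      ((hasFDerivAt_id (𝕜 := ℝ) x).const_smul (((n : ℝ) + 1)⁻¹))
  rw [h.fderiv, ContinuousLinearMap.comp_smul, ContinuousLinearMap.comp_id, norm_smul, norm_inv,
    Real.norm_of_nonneg (by positivity), inv_mul_eq_div]
  gcongr
  exact hK _

/-- The truncated particle energy. -/
noncomputable def cutEnergy (n : ℕ) (p : V3) : ℝ := energy p * cutoff n p

lemma contDiff_cutEnergy (n : ℕ) : ContDiff ℝ ∞ (cutEnergy n) :=
  contDiff_energy.mul (contDiff_cutoff n)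

lemma hasCompactSupport_cutEnergy (n : ℕ) : HasCompactSupport (cutEnergy n) :=
  (hasCompactSupport_cutoff n).mul_left

lemma cutEnergy_nonneg (n : ℕ) (p : V3) : 0 ≤ cutEnergy n p :=
  mul_nonneg (energy_pos p).le (cutoff_nonneg n p)

lemma cutEnergy_le (n : ℕ) (p : V3) : cutEnergy n p ≤ energy p :=
  mul_le_of_le_one_right (energy_pos p).le (cutoff_le_one n p)

lemma fderiv_cutEnergy (n : ℕ) (p : V3) :
    fderiv ℝ (cutEnergy n) p = energy p • fderiv ℝ (cutoff n) p + cutoff n p • fderiv ℝ energy p :=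
  fderiv_mul ((contDiff_energy.differentiable (by simp)) p)
    (((contDiff_cutoff n).differentiable (by simp)) p)

/-- The derivative of the cutoff lives where `energy p` is of order `n + 1` and has size of order `1
/ (n + 1)`, so the product stays bounded. Hence the force term costs only `(|E| + |B|) f`, with no
weight in `p`. -/
lemma exists_norm_fderiv_cutEnergy_le :
    ∃ K : ℝ, 0 ≤ K ∧ ∀ n p, ‖fderiv ℝ (cutEnergy n) p‖ ≤ K := by
  obtain ⟨K, hK0, hK⟩ := exists_norm_fderiv_cutoff_le
  refine ⟨3 * K + 1, by positivity, fun n p => ?_⟩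
  rw [fderiv_cutEnergy]
  refine (norm_add_le _ _).trans (add_le_add ?_ ?_)
  · rcases lt_or_ge (2 * ((n : ℝ) + 1)) ‖p‖ with h | h
    · rw [fderiv_cutoff_eq_zero_of_gt h, smul_zero, norm_zero]; positivity
    · rw [norm_smul, Real.norm_of_nonneg (energy_pos p).le]
      have hn : (0 : ℝ) ≤ n := n.cast_nonneg
      -- Here `energy p ≤ 1 + ‖p‖ ≤ 1 + 2 (n + 1) ≤ 3 (n + 1)`.
      calc energy p * ‖fderiv ℝ (cutoff n) p‖
          ≤ (3 * ((n : ℝ) + 1)) * (K / (n + 1)) := by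
            gcongr
            · linarith [energy_le p]
            · exact hK n p
        _ = 3 * K := by field_simp
  · rw [norm_smul, Real.norm_of_nonneg (cutoff_nonneg n p)]
    exact mul_le_one₀ (cutoff_le_one n p) (norm_nonneg _) (norm_fderiv_energy_le p)

lemma fderiv_cutEnergy_apply_of_lt {n : ℕ} {p : V3} (h : ‖p‖ < n + 1) (w : V3) :
    fderiv ℝ (cutEnergy n) p w = inner ℝ (vel p) w := by
  rw [fderiv_cutEnergy, fderiv_cutoff_eq_zero_of_lt h, cutoff_eq_one h.le, smul_zero, zero_add,
    one_smul, fderiv_energy_apply]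

lemma cutEnergy_of_le {n : ℕ} {p : V3} (h : ‖p‖ ≤ n + 1) : cutEnergy n p = energy p := by
  rw [cutEnergy, cutoff_eq_one h, mul_one]

/-! ### The space-time test function -/

/-- The test function `θ(t) χ(x/n) √(1+|p|²) χ(p/n)`. -/
noncomputable def energyTest (θ : ℝ → ℝ) (n : ℕ) (z : ℝ × V3 × V3) : ℝ :=
  θ z.1 * (cutoff n z.2.1 * cutEnergy n z.2.2)

lemma isTest_energyTest {T : ℝ} {θ : ℝ → ℝ} (hθ : ContDiff ℝ ∞ θ) (hθc : HasCompactSupport θ)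
    (hθT : tsupport θ ⊆ Iio T) (n : ℕ) : IsTest T (energyTest θ n) where
  smooth := (hθ.comp contDiff_fst).mul (((contDiff_cutoff n).comp (contDiff_fst.comp contDiff_snd)).mul
    ((contDiff_cutEnergy n).comp (contDiff_snd.comp contDiff_snd)))
  compact := by
    refine HasCompactSupport.of_support_subset_isCompact
      (hθc.isCompact.prod ((hasCompactSupport_cutoff n).isCompact.prod
        (hasCompactSupport_cutEnergy n).isCompact)) fun z hz => ?_
    have h := mul_ne_zero_iff.1 hz
    have h' := mul_ne_zero_iff.1 h.2
    exact ⟨subset_tsupport _ h.1, subset_tsupport _ h'.1, subset_tsupport _ h'.2⟩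
  support := by
    have : tsupport (energyTest θ n) ⊆ tsupport θ ×ˢ univ := by
      refine closure_minimal (fun z hz => ⟨subset_tsupport _ (mul_ne_zero_iff.1 hz).1, mem_univ _⟩)
        ((isClosed_tsupport _).prod isClosed_univ)
    exact this.trans (prod_mono hθT subset_rfl)

lemma fderiv_energyTest_apply {θ : ℝ → ℝ} (hθ : ContDiff ℝ ∞ θ) (n : ℕ) (t : ℝ) (x p : V3)
    (a : ℝ) (b c : V3) :
    fderiv ℝ (energyTest θ n) (t, x, p) (a, b, c)
      = a * deriv θ t * (cutoff n x * cutEnergy n p)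
        + θ t * (fderiv ℝ (cutoff n) x b * cutEnergy n p)
        + θ t * (cutoff n x * fderiv ℝ (cutEnergy n) p c) := by
  have h1 : HasFDerivAt (fun z : ℝ × V3 × V3 => θ z.1) _ (t, x, p) :=
    ((hθ.differentiable (by simp)) t).hasFDerivAt.comp (t, x, p) hasFDerivAt_fst
  have h2 : HasFDerivAt (fun z : ℝ × V3 × V3 => cutoff n z.2.1) _ (t, x, p) :=
    HasFDerivAt.comp (g := cutoff n) (f := fun z : ℝ × V3 × V3 => z.2.1) (t, x, p)
      (((contDiff_cutoff n).differentiable (by simp)) x).hasFDerivAt hasFDerivAt_snd.fst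
  have h3 : HasFDerivAt (fun z : ℝ × V3 × V3 => cutEnergy n z.2.2) _ (t, x, p) :=
    HasFDerivAt.comp (g := cutEnergy n) (f := fun z : ℝ × V3 × V3 => z.2.2) (t, x, p)
      (((contDiff_cutEnergy n).differentiable (by simp)) p).hasFDerivAt hasFDerivAt_snd.snd
  have h : HasFDerivAt (energyTest θ n) _ (t, x, p) := h1.mul (h2.mul h3)
  rw [h.fderiv]
  have : fderiv ℝ θ t a = a * deriv θ t := by rw [fderiv_eq_smul_deriv, smul_eq_mul]
  simp [this]
  ring

/-! ### From a weak to an integrated identity in time -/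

/-- A function whose weak time derivative is integrable, with initial value `c`, is a.e. the
integral of that derivative. -/
theorem ae_eq_add_integral_of_weak_deriv {T c : ℝ} (hT : 0 < T) {K J : ℝ → ℝ}
    (hK : IntegrableOn K (Ioo 0 T)) (hJ : IntegrableOn J (Ioo 0 T))
    (h : ∀ θ : ℝ → ℝ, ContDiff ℝ ∞ θ → HasCompactSupport θ → tsupport θ ⊆ Iio T →
      ∫ t in Ioo 0 T, (deriv θ t * K t + θ t * J t) = -(θ 0 * c)) :
    ∀ᵐ t ∂(volume.restrict (Ioo 0 T)), K t = c + ∫ s in (0 : ℝ)..t, J s := by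
  have hJi : IntervalIntegrable J volume 0 T :=
    (intervalIntegrable_iff_integrableOn_Ioo_of_le hT.le).2 hJ
  set P : ℝ → ℝ := fun t => ∫ s in (0 : ℝ)..t, J s with hP
  have hPac : AbsolutelyContinuousOnInterval P 0 T :=
    hJi.absolutelyContinuousOnInterval_intervalIntegral (by simp)
  have hPc : ContinuousOn P (Icc 0 T) := by
    simpa [uIcc_of_le hT.le] using hPac.continuousOn
  have hPi : IntegrableOn P (Ioo 0 T) :=
    (hPc.integrableOn_Icc).mono_set Ioo_subset_Icc_self
  have hci : IntegrableOn (fun _ : ℝ => c) (Ioo 0 T) := integrableOn_const (by simp)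
  -- By the fundamental lemma of the calculus of variations it suffices to test against `g`
  -- supported in `]0,T[`; the hypothesis is then applied to a primitive of `g`.
  have key : ∀ᵐ t, t ∈ Ioo 0 T → K t - c - P t = 0 := by
    refine isOpen_Ioo.ae_eq_zero_of_integral_contDiff_smul_eq_zero
      ((hK.sub hci).sub hPi).locallyIntegrableOn fun g hg hgc hgs => ?_
    -- A gap before `T` is needed: the support of the primitive must stay strictly to the left of
    -- `T`.
    obtain ⟨b, hbT, hb⟩ : ∃ b < T, ∀ t, b < t → g t = 0 := by
      rcases (tsupport g).eq_empty_or_nonempty with he | hne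
      · exact ⟨0, hT, fun t _ => by rw [tsupport_eq_empty_iff.1 he]; rfl⟩
      · obtain ⟨b, hb, hb'⟩ := hgc.isCompact.exists_isGreatest hne
        exact ⟨b, (hgs hb).2, fun t ht => by
          by_contra hne
          exact absurd (hb' (subset_tsupport _ hne)) (not_le.2 ht)⟩
    -- Based at `T`, the primitive vanishes near `T` but may be a nonzero constant on the negative
    -- axis, so it lacks compact support.
    set Θ : ℝ → ℝ := fun t => ∫ s in T..t, g s with hΘ
    have hΘd : ∀ t, HasDerivAt Θ (g t) t := fun t =>
      intervalIntegral.integral_hasDerivAt_right (hg.continuous.intervalIntegrable _ _)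
        (hg.continuous.stronglyMeasurableAtFilter _ _) hg.continuous.continuousAt
    have hΘ' : deriv Θ = g := funext fun t => (hΘd t).deriv
    have hΘs : ContDiff ℝ ∞ Θ := by
      rw [contDiff_infty_iff_deriv, hΘ']
      exact ⟨fun t => (hΘd t).differentiableAt, hg⟩
    have hΘb : ∀ t, b < t → Θ t = 0 := fun t ht => by
      refine intervalIntegral.integral_zero_ae (Filter.Eventually.of_forall fun s hs => hb s ?_)
      exact lt_of_lt_of_le (lt_min hbT ht) (le_of_lt hs.1)
    have hΘT : Θ T = 0 := hΘb T hbT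
    -- The inner ball is `[-1, T + 1]`, a neighbourhood of `[0, T]`: multiplying by `η` restores
    -- compact support without changing `Θ`, its derivative or its value at `0`.
    let η : ContDiffBump (T / 2) := ⟨T / 2 + 1, T / 2 + 2, by positivity, by linarith⟩
    have hη : ∀ t ∈ Icc (-1) (T + 1), η t = 1 := fun t ht =>
      η.one_of_mem_closedBall (by
        rw [Metric.mem_closedBall, Real.dist_eq, abs_le]
        change -(T / 2 + 1) ≤ _ ∧ _ ≤ T / 2 + 1
        constructor <;> linarith [ht.1, ht.2])
    have hθ : ∀ t ∈ Icc 0 T, (fun s => η s * Θ s) =ᶠ[nhds t] Θ := fun t ht => by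
      filter_upwards [Icc_mem_nhds (show -1 < t by linarith [ht.1])
        (show t < T + 1 by linarith [ht.2])] with s hs
      rw [hη s hs, one_mul]
    have hw := h (fun s => η s * Θ s) (η.contDiff.mul hΘs) (η.hasCompactSupport.mul_right) (by
      refine (closure_minimal (fun t ht => ?_) isClosed_Iic).trans (Iic_subset_Iio.2 hbT)
      rw [mem_Iic]
      by_contra! hbt
      exact ht (by simp [hΘb t hbt]))
    have e1 : ∫ t in Ioo 0 T, (deriv (fun s => η s * Θ s) t * K t + (η t * Θ t) * J t)
        = ∫ t in Ioo 0 T, (g t * K t + Θ t * J t) := by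
      refine setIntegral_congr_fun measurableSet_Ioo fun t ht => ?_
      have := hθ t (Ioo_subset_Icc_self ht)
      simp only [this.deriv_eq, hΘ', this.eq_of_nhds]
    rw [e1, (hθ 0 ⟨le_rfl, hT.le⟩).eq_of_nhds] at hw
    have bdd : ∀ {u v : ℝ → ℝ}, Continuous u → IntegrableOn v (Ioo 0 T) →
        IntegrableOn (fun t => u t * v t) (Ioo 0 T) := fun {u v} hu hv => by
      have := ((intervalIntegrable_iff_integrableOn_Ioo_of_le hT.le).2 hv).continuousOn_mul
        (f := v) (g := u) hu.continuousOn
      exact (intervalIntegrable_iff_integrableOn_Ioo_of_le hT.le).1 this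
    have hgK := bdd hg.continuous hK
    have hgP := bdd hg.continuous hPi
    have hgc' := bdd hg.continuous hci
    have hΘJ := bdd hΘs.continuous hJ
    -- Both boundary terms vanish, since `Θ T = 0` and `P 0 = 0`.
    have ibp : ∫ t in Ioo 0 T, Θ t * J t = - ∫ t in Ioo 0 T, g t * P t := by
      have hΘac : AbsolutelyContinuousOnInterval Θ 0 T :=
        ((hΘs.of_le (by simp)).contDiffOn).absolutelyContinuousOnInterval
      have := hΘac.integral_mul_deriv_eq_deriv_mul hPac
      rw [hΘT, hΘ', show P 0 = 0 by simp [hP]] at this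
      rw [← integral_Ioc_eq_integral_Ioo, ← integral_Ioc_eq_integral_Ioo,
        ← intervalIntegral.integral_of_le hT.le, ← intervalIntegral.integral_of_le hT.le]
      have h2 : ∫ t in (0 : ℝ)..T, Θ t * J t = ∫ t in (0 : ℝ)..T, Θ t * deriv P t := by
        refine intervalIntegral.integral_congr_ae ?_
        filter_upwards [hJi.ae_hasDerivAt_integral] with t ht hmem
        rw [(ht (uIoc_subset_uIcc hmem) 0 (by simp)).deriv]
      rw [h2, this]; ring
    have hΘ0 : Θ 0 = - ∫ t in Ioo 0 T, g t := by
      rw [← integral_Ioc_eq_integral_Ioo, ← intervalIntegral.integral_of_le hT.le, hΘ]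
      exact intervalIntegral.integral_symm _ _
    rw [integral_add hgK hΘJ, ibp, hΘ0] at hw
    have hz : ∫ t, g t • (K t - c - P t) = ∫ t in Ioo 0 T, g t • (K t - c - P t) := by
      refine (setIntegral_eq_integral_of_forall_compl_eq_zero fun t ht => ?_).symm
      rw [image_eq_zero_of_notMem_tsupport fun hmem => ht (hgs hmem), zero_smul]
    rw [hz]
    have e2 : ∀ t, g t • (K t - c - P t) = g t * K t - g t * c - g t * P t := fun t => by
      rw [smul_eq_mul]; ring
    simp_rw [e2]
    rw [integral_sub (f := fun t => g t * K t - g t * c) (hgK.sub hgc') hgP, integral_sub hgK hgc', integral_mul_const]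
    linarith
  rw [ae_restrict_iff' measurableSet_Ioo]
  filter_upwards [key] with t ht hmem
  linarith [ht hmem]

/-! ### Integrability of field times density -/

lemma lintegral_enorm_sq_eq {α F : Type*} [MeasurableSpace α] {μ : Measure α}
    [TopologicalSpace F] [ContinuousENorm F] (u : α → F) :
    ∫⁻ x, ‖u x‖ₑ ^ 2 ∂μ = eLpNorm u 2 μ ^ 2 := by
  have h := eLpNorm_nnreal_pow_eq_lintegral (μ := μ) (f := u) (p := 2) (by simp)
  simpa using h.symm

lemma aestronglyMeasurable_field {Y : Type*} [TopologicalSpace Y] {μ : Measure ℝ} [SFinite μ]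
    {u : ℝ → V3 → Y}
    (hu : AEStronglyMeasurable (fun z : ℝ × V3 => u z.1 z.2) (μ.prod volume)) :
    AEStronglyMeasurable (fun z : ℝ × V3 × V3 => u z.1 z.2.1) (μ.prod volume) :=
  hu.comp_quasiMeasurePreserving (f := fun z : ℝ × V3 × V3 => (z.1, z.2.1))
    (Measure.quasiMeasurePreserving_fst.comp ((measurePreserving_prodAssoc μ (volume : Measure V3)
      (volume : Measure V3)).symm MeasurableEquiv.prodAssoc).quasiMeasurePreserving)

/-- Small momenta are controlled by the bound `C` on `g`, large momenta by its moment. -/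
lemma lintegral_field_mul_le {lam : ℝ} (hlam : 0 < lam) {g : V3 × V3 → ℝ} {u : V3 → V3} {C : ℝ≥0∞}
    (hg : AEStronglyMeasurable g) (hu : AEStronglyMeasurable u) (hg0 : ∀ᵐ z, 0 ≤ g z)
    (hgC : ∀ᵐ z, ‖g z‖ₑ ≤ C) :
    ∫⁻ z : V3 × V3, ‖u z.1‖ₑ * ‖g z‖ₑ
      ≤ (∫⁻ z, ‖g z‖ₑ) + (∫⁻ x, ‖u x‖ₑ ^ 2) * (C * volume (Metric.ball (0 : V3) 1))
        + ((∫⁻ x, ‖u x‖ₑ ^ 2) + ∫⁻ x, (∫⁻ p : V3, ENNReal.ofReal (‖p‖ ^ lam * g (x, p))) ^ 2) := by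
  have hu1 : AEMeasurable (fun z : V3 × V3 => ‖u z.1‖ₑ) volume :=
    (hu.comp_quasiMeasurePreserving Measure.quasiMeasurePreserving_fst).enorm
  have hb : Measurable ((Metric.ball (0 : V3) 1).indicator fun _ => C) :=
    measurable_const.indicator measurableSet_ball
  have hmom : AEMeasurable (fun z : V3 × V3 => ENNReal.ofReal (‖z.2‖ ^ lam * g z)) volume := by
    refine AEMeasurable.ennreal_ofReal (AEMeasurable.mul ?_ hg.aemeasurable)
    exact (measurable_snd.norm.pow_const lam).aemeasurable
  have hmid : AEMeasurable (fun z : V3 × V3 =>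
      ‖u z.1‖ₑ ^ 2 * (Metric.ball (0 : V3) 1).indicator (fun _ => C) z.2) volume :=
    (hu1.pow_const 2).mul (hb.comp measurable_snd).aemeasurable
  calc ∫⁻ z : V3 × V3, ‖u z.1‖ₑ * ‖g z‖ₑ
      ≤ ∫⁻ z : V3 × V3, (‖g z‖ₑ + ‖u z.1‖ₑ ^ 2 * (Metric.ball (0 : V3) 1).indicator (fun _ => C) z.2
          + ‖u z.1‖ₑ * ENNReal.ofReal (‖z.2‖ ^ lam * g z)) := by
        refine lintegral_mono_ae ?_
        filter_upwards [hg0, hgC] with z h0 hC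
        by_cases hz : z.2 ∈ Metric.ball (0 : V3) 1
        · rw [indicator_of_mem hz]
          refine le_trans ?_ le_self_add
          -- Small momenta: either `|u| ≤ 1` and `|u| g ≤ g`, or `|u| ≤ |u|²` and `g ≤ C`.
          rcases le_total ‖u z.1‖ₑ 1 with h | h
          · exact le_add_right (mul_le_of_le_one_left' h)
          · refine le_add_left (mul_le_mul' ?_ hC)
            exact le_self_pow₀ h two_ne_zero
        -- Large momenta: `1 ≤ |p|^lam`, so `g` is at most its moment density.
        · refine le_add_left (mul_le_mul_right ?_ _)
          rw [Real.enorm_of_nonneg h0]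
          refine ENNReal.ofReal_le_ofReal (le_mul_of_one_le_left h0 ?_)
          rw [mem_ball_zero_iff, not_lt] at hz
          exact Real.one_le_rpow hz hlam.le
    _ = (∫⁻ z, ‖g z‖ₑ) + (∫⁻ x, ‖u x‖ₑ ^ 2) * (C * volume (Metric.ball (0 : V3) 1))
        + ∫⁻ x, ‖u x‖ₑ * ∫⁻ p : V3, ENNReal.ofReal (‖p‖ ^ lam * g (x, p)) := by
        rw [lintegral_add_left' (f := fun z : V3 × V3 => ‖g z‖ₑ + ‖u z.1‖ₑ ^ 2 *
            (Metric.ball (0 : V3) 1).indicator (fun _ => C) z.2) (hg.enorm.add hmid),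
          lintegral_add_left' hg.enorm]
        refine congrArg₂ _ (congrArg _ ?_) ?_
        · rw [Measure.volume_eq_prod, lintegral_prod_mul (hu.enorm.pow_const 2) hb.aemeasurable,
            lintegral_indicator_const measurableSet_ball]
        · rw [Measure.volume_eq_prod, lintegral_prod
            (fun z : V3 × V3 => ‖u z.1‖ₑ * ENNReal.ofReal (‖z.2‖ ^ lam * g z)) (hu1.mul hmom)]
          refine lintegral_congr fun x => ?_
          exact lintegral_const_mul' _ _ (enorm_ne_top (x := u x))
    _ ≤ _ := by
        gcongr
        rw [← lintegral_add_left' (hu.enorm.pow_const 2)]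
        refine lintegral_mono fun x => ?_
        -- The bound `a b ≤ a² + b²`, obtained from `a b ≤ max(a, b)²`; this form is also valid for
        -- infinite values.
        rcases le_total ‖u x‖ₑ (∫⁻ p : V3, ENNReal.ofReal (‖p‖ ^ lam * g (x, p))) with h | h
        · exact le_add_left ((mul_le_mul_left h _).trans_eq (sq _).symm)
        · exact le_add_right ((mul_le_mul_right h _).trans_eq (sq _).symm)

lemma lintegral_enorm_le_of_energy {g : V3 × V3 → ℝ} (hg : MemL1Kin g) {C : ℝ≥0}
    (hC : ∫ z, energy z.2 * g z ≤ C) : ∫⁻ z, ‖energy z.2 * g z‖ₑ ≤ C := by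
  rw [← ofReal_integral_norm_eq_lintegral_enorm hg.energy_integrable]
  refine ENNReal.ofReal_le_of_le_toReal ?_
  refine le_trans (le_of_eq (integral_congr_ae ?_)) hC
  filter_upwards [hg.nonneg] with z hz
  exact Real.norm_of_nonneg (mul_nonneg (energy_pos _).le hz)

lemma MemLinftyKin.integrable_energy_mul {T : ℝ} {f : ℝ → V3 × V3 → ℝ} (hf : MemLinftyKin T f) :
    Integrable (fun z : ℝ × V3 × V3 => energy z.2.2 * f z.1 z.2)
      ((volume.restrict (Ioo 0 T)).prod volume) := by
  have hm : AEStronglyMeasurable (fun z : ℝ × V3 × V3 => energy z.2.2 * f z.1 z.2)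
      ((volume.restrict (Ioo 0 T)).prod volume) :=
    (continuous_energy.comp (continuous_snd.comp continuous_snd)).aestronglyMeasurable.mul
      hf.measurable
  refine ⟨hm, ?_⟩
  obtain ⟨C, hC⟩ := hf.bound
  rw [HasFiniteIntegral, lintegral_prod _ hm.enorm]
  calc _ ≤ ∫⁻ t in Ioo 0 T, (C : ℝ≥0∞) := by
        refine lintegral_mono_ae ?_
        filter_upwards [hf.mem, hC] with t h1 h2
        exact lintegral_enorm_le_of_energy h1.1 h2.1
    _ < ⊤ := by simp [ENNReal.mul_lt_top]

/-- The estimate of `lintegral_field_mul_le` holds on almost every time slice with constants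
independent of `t`, and the time interval has finite length. It serves for both `E` and `B`. -/
lemma integrable_field_mul {T lam : ℝ} (hlam : 0 < lam) {f : ℝ → V3 × V3 → ℝ} {u : ℝ → V3 → V3}
    (hf : MemLinftyKin T f) (hu : MemLinftyL2 T u)
    (hrho : ∃ C : ℝ≥0, ∀ᵐ t ∂(volume.restrict (Ioo 0 T)), eLpNorm (rhoMoment lam f t) 2 volume ≤ C) :
    Integrable (fun z : ℝ × V3 × V3 => ‖u z.1 z.2.1‖ * f z.1 z.2)
      ((volume.restrict (Ioo 0 T)).prod volume) := by
  have hm : AEStronglyMeasurable (fun z : ℝ × V3 × V3 => ‖u z.1 z.2.1‖ * f z.1 z.2)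
      ((volume.restrict (Ioo 0 T)).prod volume) :=
    (aestronglyMeasurable_field hu.measurable).norm.mul hf.measurable
  refine ⟨hm, ?_⟩
  obtain ⟨C, hC⟩ := hf.bound
  obtain ⟨A, hA⟩ := hu.bound
  obtain ⟨D, hD⟩ := hrho
  rw [HasFiniteIntegral, lintegral_prod _ hm.enorm]
  calc _ ≤ ∫⁻ t in Ioo 0 T, ((C : ℝ≥0∞) + (A : ℝ≥0∞) ^ 2 * (C * volume (Metric.ball (0 : V3) 1))
          + ((A : ℝ≥0∞) ^ 2 + (D : ℝ≥0∞) ^ 2)) := by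
        refine lintegral_mono_ae ?_
        filter_upwards [hf.mem, hC, hA, hD, hu.measurable.prodMk_left] with t h1 h2 h3 h4 h5
        simp only [enorm_mul, enorm_norm]
        refine (lintegral_field_mul_le (C := C) hlam h1.1.integrable.1 h5 h1.1.nonneg ?_).trans ?_
        · filter_upwards [enorm_ae_le_eLpNormEssSup (f t) volume] with z hz
          exact hz.trans (by simpa using h2.2)
        · rw [lintegral_enorm_sq_eq]
          have hr : ∫⁻ x, (∫⁻ p : V3, ENNReal.ofReal (‖p‖ ^ lam * f t (x, p))) ^ 2
              = eLpNorm (rhoMoment lam f t) 2 volume ^ 2 := by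
            rw [← lintegral_enorm_sq_eq]; rfl
          rw [hr]
          gcongr
          refine le_trans (lintegral_mono fun z => ?_) (lintegral_enorm_le_of_energy h1.1 h2.1)
          rw [enorm_mul, Real.enorm_of_nonneg (energy_pos _).le]
          refine le_mul_of_one_le_left zero_le ?_
          exact ENNReal.one_le_ofReal.2 (one_le_energy _)
    _ < ⊤ := by
        have : volume (Metric.ball (0 : V3) 1) < ⊤ := measure_ball_lt_top
        rw [lintegral_const]
        refine ENNReal.mul_lt_top ?_ (by simp)
        simp only [ENNReal.add_lt_top]
        refine ⟨⟨by simp, ENNReal.mul_lt_top (by simp) (ENNReal.mul_lt_top (by simp) this)⟩,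
          by simp, by simp⟩

/-! ### The power `E · j` -/

section

variable {T : ℝ} {f : ℝ → V3 × V3 → ℝ} {E B : ℝ → V3 → V3}

lemma MemLinftyKin.integrable (hf : MemLinftyKin T f) :
    Integrable (fun z : ℝ × V3 × V3 => f z.1 z.2) ((volume.restrict (Ioo 0 T)).prod volume) := by
  refine hf.integrable_energy_mul.mono hf.measurable (Filter.Eventually.of_forall fun z => ?_)
  rw [norm_mul, Real.norm_of_nonneg (energy_pos _).le]
  exact le_mul_of_one_le_left (norm_nonneg _) (one_le_energy _)

/-- Regroups the variables so that `p` can be integrated out over `(t, x)`. -/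
lemma integrable_prodAssoc {F : Type*} [NormedAddCommGroup F] {μ : Measure ℝ} [SFinite μ]
    {w : ℝ × V3 × V3 → F} (hw : Integrable w (μ.prod volume)) :
    Integrable (fun y : (ℝ × V3) × V3 => w (y.1.1, y.1.2, y.2)) ((μ.prod volume).prod volume) :=
  (measurePreserving_prodAssoc μ (volume : Measure V3) (volume : Measure V3)).integrable_comp_of_integrable
    hw

lemma inner_current_eq {t : ℝ} {x : V3} (h : Integrable fun p => f t (x, p)) :
    inner ℝ (E t x) (current f t x) = ∫ p, f t (x, p) * inner ℝ (E t x) (vel p) := by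
  have hv : Integrable fun p => f t (x, p) • vel p := by
    refine h.mono (h.1.smul continuous_vel.aestronglyMeasurable)
      (Filter.Eventually.of_forall fun p => ?_)
    rw [norm_smul]
    exact mul_le_of_le_one_right (norm_nonneg _) (norm_vel_le_one p)
  rw [current, ← integral_inner hv]
  simp_rw [real_inner_smul_right]

lemma aestronglyMeasurable_vel {μ : Measure ℝ} :
    AEStronglyMeasurable (fun z : ℝ × V3 × V3 => vel z.2.2) (μ.prod volume) :=
  (continuous_vel.comp (continuous_snd.comp continuous_snd)).aestronglyMeasurable

/-- The power density `f v · E` is integrable as soon as `|E| f` is. -/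
lemma integrable_power (hf : MemLinftyKin T f) (hE : MemLinftyL2 T E)
    (hEf : Integrable (fun z : ℝ × V3 × V3 => ‖E z.1 z.2.1‖ * f z.1 z.2)
      ((volume.restrict (Ioo 0 T)).prod volume)) :
    Integrable (fun z : ℝ × V3 × V3 => f z.1 z.2 * inner ℝ (E z.1 z.2.1) (vel z.2.2))
      ((volume.restrict (Ioo 0 T)).prod volume) := by
  refine hEf.mono (hf.measurable.mul
    ((aestronglyMeasurable_field hE.measurable).inner aestronglyMeasurable_vel))
    (Filter.Eventually.of_forall fun z => ?_)
  rw [norm_mul, norm_mul, norm_norm, mul_comm]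
  gcongr
  exact (norm_inner_le_norm _ _).trans (mul_le_of_le_one_right (norm_nonneg _) (norm_vel_le_one _))

/-- The inner product passes under the integral only where `f t (x, ·)` is integrable, which Fubini
grants for almost every `(t, x)`. -/
lemma ae_inner_current_eq (hf : MemLinftyKin T f) :
    ∀ᵐ y ∂((volume.restrict (Ioo 0 T)).prod (volume : Measure V3)),
      inner ℝ (E y.1 y.2) (current f y.1 y.2)
        = ∫ p, f y.1 (y.2, p) * inner ℝ (E y.1 y.2) (vel p) := by
  filter_upwards [(integrable_prodAssoc hf.integrable).prod_right_ae] with y hy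
  exact inner_current_eq hy

lemma integrable_inner_current (hf : MemLinftyKin T f)
    (hW : Integrable (fun z : ℝ × V3 × V3 => f z.1 z.2 * inner ℝ (E z.1 z.2.1) (vel z.2.2))
      ((volume.restrict (Ioo 0 T)).prod volume)) :
    Integrable (fun z : ℝ × V3 => inner ℝ (E z.1 z.2) (current f z.1 z.2))
      ((volume.restrict (Ioo 0 T)).prod volume) := by
  refine (integrable_prodAssoc hW).integral_prod_left.congr ?_
  filter_upwards [ae_inner_current_eq hf] with y hy
  exact hy.symm

lemma ae_integral_power_eq (hf : MemLinftyKin T f)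
    (hW : Integrable (fun z : ℝ × V3 × V3 => f z.1 z.2 * inner ℝ (E z.1 z.2.1) (vel z.2.2))
      ((volume.restrict (Ioo 0 T)).prod volume)) :
    ∀ᵐ t ∂(volume.restrict (Ioo 0 T)),
      ∫ z : V3 × V3, f t z * inner ℝ (E t z.1) (vel z.2)
        = ∫ x, inner ℝ (E t x) (current f t x) := by
  filter_upwards [hW.prod_right_ae, Measure.ae_ae_of_ae_prod (ae_inner_current_eq (E := E) hf)]
    with t h1 h2
  rw [Measure.volume_eq_prod, integral_prod _ h1]
  exact integral_congr_ae (h2.mono fun x hx => hx.symm)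

/-! ### The truncated energy in the Vlasov equation, and the limit -/

/-- The Vlasov integrand against the truncated energy test function. -/
noncomputable def vlasovIntegrand (f : ℝ → V3 × V3 → ℝ) (E B : ℝ → V3 → V3) (θ : ℝ → ℝ) (n : ℕ)
    (z : ℝ × V3 × V3) : ℝ :=
  f z.1 z.2 * (fderiv ℝ (energyTest θ n) z (1, 0, 0)
    + fderiv ℝ (energyTest θ n) z (0, vel z.2.2, 0)
    + fderiv ℝ (energyTest θ n) z (0, 0, lorentz E B z.1 z.2.1 z.2.2))

lemma vlasovIntegrand_eq {θ : ℝ → ℝ} (hθ : ContDiff ℝ ∞ θ) (n : ℕ) (z : ℝ × V3 × V3) :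
    vlasovIntegrand f E B θ n z = f z.1 z.2 * (deriv θ z.1 * (cutoff n z.2.1 * cutEnergy n z.2.2)
      + θ z.1 * (fderiv ℝ (cutoff n) z.2.1 (vel z.2.2) * cutEnergy n z.2.2)
      + θ z.1 * (cutoff n z.2.1 *
          fderiv ℝ (cutEnergy n) z.2.2 (lorentz E B z.1 z.2.1 z.2.2))) := by
  obtain ⟨t, x, p⟩ := z
  simp only [vlasovIntegrand, fderiv_energyTest_apply hθ, map_zero]
  ring

lemma aestronglyMeasurable_lorentz (hE : MemLinftyL2 T E) (hB : MemLinftyL2 T B) :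
    AEStronglyMeasurable (fun z : ℝ × V3 × V3 => lorentz E B z.1 z.2.1 z.2.2)
      ((volume.restrict (Ioo 0 T)).prod volume) := by
  have hE' := aestronglyMeasurable_field hE.measurable
  have hB' := aestronglyMeasurable_field hB.measurable
  have h := continuous_cross.comp_aestronglyMeasurable (aestronglyMeasurable_vel.prodMk hB')
  unfold lorentz
  exact hE'.add h

lemma aestronglyMeasurable_vlasovIntegrand (hf : MemLinftyKin T f) (hE : MemLinftyL2 T E)
    (hB : MemLinftyL2 T B) {θ : ℝ → ℝ} (hθ : ContDiff ℝ ∞ θ) (hθc : HasCompactSupport θ)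
    (hθT : tsupport θ ⊆ Iio T) (n : ℕ) :
    AEStronglyMeasurable (vlasovIntegrand f E B θ n)
      ((volume.restrict (Ioo 0 T)).prod volume) := by
  have hD : Continuous (fderiv ℝ (energyTest θ n)) :=
    (isTest_energyTest hθ hθc hθT n).smooth.continuous_fderiv (by simp)
  have happ : ∀ {w : ℝ × V3 × V3 → ℝ × V3 × V3},
      AEStronglyMeasurable w ((volume.restrict (Ioo 0 T)).prod volume) →
      AEStronglyMeasurable (fun z => fderiv ℝ (energyTest θ n) z (w z))
        ((volume.restrict (Ioo 0 T)).prod volume) := fun {w} hw =>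
    (isBoundedBilinearMap_apply (𝕜 := ℝ)).continuous.comp_aestronglyMeasurable
      (hD.aestronglyMeasurable.prodMk hw)
  have hL : AEStronglyMeasurable (fun z : ℝ × V3 × V3 => lorentz E B z.1 z.2.1 z.2.2)
      ((volume.restrict (Ioo 0 T)).prod volume) :=
    aestronglyMeasurable_lorentz hE hB
  have h1 := happ (w := fun _ => (1, 0, 0)) aestronglyMeasurable_const
  have h2 := happ (w := fun z => (0, vel z.2.2, 0)) (aestronglyMeasurable_const.prodMk
    (aestronglyMeasurable_vel.prodMk aestronglyMeasurable_const))
  have h3 := happ (w := fun z => (0, 0, lorentz E B z.1 z.2.1 z.2.2))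
    (aestronglyMeasurable_const.prodMk (aestronglyMeasurable_const.prodMk hL))
  unfold vlasovIntegrand
  exact hf.measurable.mul ((h1.add h2).add h3)

/-- `M` depends on `θ` and the fixed cutoff profile but not on `n`, as domination requires. The
energy weight absorbs the time and transport terms; the fields absorb the force term. -/
lemma exists_vlasovIntegrand_bound {θ : ℝ → ℝ} (hθ : ContDiff ℝ ∞ θ) (hθc : HasCompactSupport θ) :
    ∃ M : ℝ, ∀ (f : ℝ → V3 × V3 → ℝ) (E B : ℝ → V3 → V3) (n : ℕ) (z : ℝ × V3 × V3),
      ‖vlasovIntegrand f E B θ n z‖ ≤ M * (‖energy z.2.2 * f z.1 z.2‖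
        + ‖‖E z.1 z.2.1‖ * f z.1 z.2‖ + ‖‖B z.1 z.2.1‖ * f z.1 z.2‖) := by
  obtain ⟨a, ha⟩ := hθ.continuous.bounded_above_of_compact_support hθc
  obtain ⟨b, hb⟩ := (hθ.continuous_deriv (by simp)).bounded_above_of_compact_support hθc.deriv
  obtain ⟨K, hK0, hK⟩ := exists_norm_fderiv_cutoff_le
  obtain ⟨K', hK0', hK'⟩ := exists_norm_fderiv_cutEnergy_le
  have ha0 : 0 ≤ a := (norm_nonneg _).trans (ha 0)
  have hb0 : 0 ≤ b := (norm_nonneg _).trans (hb 0)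
  refine ⟨b + a * K + a * K', fun f E B n z => ?_⟩
  have hc : ‖cutoff n z.2.1‖ ≤ 1 := by
    rw [Real.norm_of_nonneg (cutoff_nonneg _ _)]; exact cutoff_le_one _ _
  have he : ‖cutEnergy n z.2.2‖ ≤ energy z.2.2 := by
    rw [Real.norm_of_nonneg (cutEnergy_nonneg _ _)]; exact cutEnergy_le _ _
  have hK1 : ‖fderiv ℝ (cutoff n) z.2.1‖ ≤ K :=
    (hK _ _).trans (div_le_self hK0 (by linarith [n.cast_nonneg (α := ℝ)]))
  have he0 := (energy_pos z.2.2).le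
  have hL := norm_lorentz_le E B z.1 z.2.1 z.2.2
  have alg : ∀ r w x y : ℝ, 0 ≤ r → 0 ≤ w → 0 ≤ x → 0 ≤ y →
      r * (b * (1 * w) + a * (K * 1 * w) + a * (1 * (K' * (x + y))))
        ≤ (b + a * K + a * K') * (w * r + x * r + y * r) := fun r w x y hr hw hx hy => by
    have : 0 ≤ r * (a * K' * w + (b + a * K) * (x + y)) := by positivity
    linarith
  rw [vlasovIntegrand_eq hθ, norm_mul (f z.1 z.2), norm_mul (energy _), norm_mul ‖E _ _‖,
    norm_mul ‖B _ _‖, norm_norm, norm_norm, Real.norm_of_nonneg he0]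
  generalize lorentz E B z.1 z.2.1 z.2.2 = L at hL ⊢
  have h1 : ‖deriv θ z.1 * (cutoff n z.2.1 * cutEnergy n z.2.2)‖ ≤ b * (1 * energy z.2.2) := by
    rw [norm_mul, norm_mul]; gcongr; exact hb _
  have h2 : ‖θ z.1 * (fderiv ℝ (cutoff n) z.2.1 (vel z.2.2) * cutEnergy n z.2.2)‖
      ≤ a * (K * 1 * energy z.2.2) := by
    rw [norm_mul, norm_mul]
    gcongr
    · exact ha _
    · exact (ContinuousLinearMap.le_opNorm _ _).trans (by gcongr; exact norm_vel_le_one _)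
  have h3 : ‖θ z.1 * (cutoff n z.2.1 * fderiv ℝ (cutEnergy n) z.2.2 L)‖
      ≤ a * (1 * (K' * (‖E z.1 z.2.1‖ + ‖B z.1 z.2.1‖))) := by
    rw [norm_mul, norm_mul]
    gcongr
    · exact ha _
    · exact (ContinuousLinearMap.le_opNorm _ _).trans (by gcongr; exact hK' _ _)
  have hsum := (norm_add₃_le (a := deriv θ z.1 * (cutoff n z.2.1 * cutEnergy n z.2.2))
    (b := θ z.1 * (fderiv ℝ (cutoff n) z.2.1 (vel z.2.2) * cutEnergy n z.2.2))
    (c := θ z.1 * (cutoff n z.2.1 * fderiv ℝ (cutEnergy n) z.2.2 L))).trans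
    (add_le_add (add_le_add h1 h2) h3)
  refine (mul_le_mul_of_nonneg_left hsum (norm_nonneg _)).trans 
    (alg _ _ _ _ (norm_nonneg _) he0 (norm_nonneg _) (norm_nonneg _))

/-- At a fixed point the sequence is eventually constant: once `n` exceeds `|x|` and `|p|`, the
cutoffs equal `1` nearby, the transport term vanishes and the magnetic part drops out. -/
lemma tendsto_vlasovIntegrand {θ : ℝ → ℝ} (hθ : ContDiff ℝ ∞ θ) (z : ℝ × V3 × V3) :
    Filter.Tendsto (fun n => vlasovIntegrand f E B θ n z) Filter.atTop
      (nhds (deriv θ z.1 * (energy z.2.2 * f z.1 z.2)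
        + θ z.1 * (f z.1 z.2 * inner ℝ (E z.1 z.2.1) (vel z.2.2)))) := by
  obtain ⟨N, hN⟩ := exists_nat_gt (max ‖z.2.1‖ ‖z.2.2‖)
  refine tendsto_const_nhds.congr' ?_
  filter_upwards [Filter.eventually_ge_atTop N] with n hn
  have hn' : (N : ℝ) ≤ n := by exact_mod_cast hn
  have hx : ‖z.2.1‖ < n + 1 := by linarith [le_max_left ‖z.2.1‖ ‖z.2.2‖]
  have hp : ‖z.2.2‖ < n + 1 := by linarith [le_max_right ‖z.2.1‖ ‖z.2.2‖]
  rw [vlasovIntegrand_eq hθ, cutoff_eq_one hx.le, cutEnergy_of_le hp.le,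
    fderiv_cutoff_eq_zero_of_lt hx, fderiv_cutEnergy_apply_of_lt hp, inner_vel_lorentz]
  simp only [zero_apply]
  ring

lemma tendsto_initial {f₀ : V3 × V3 → ℝ} (hf₀ : MemL1Kin f₀) (θ : ℝ → ℝ) :
    Filter.Tendsto (fun n => ∫ z : V3 × V3, f₀ z * energyTest θ n (0, z)) Filter.atTop
      (nhds (θ 0 * ∫ z : V3 × V3, energy z.2 * f₀ z)) := by
  rw [← integral_const_mul]
  refine tendsto_integral_of_dominated_convergence (fun z => |θ 0| * ‖energy z.2 * f₀ z‖)
    (fun n => ?_) (hf₀.energy_integrable.norm.const_mul _) (fun n => ?_) ?_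
  · refine hf₀.integrable.1.mul (Continuous.aestronglyMeasurable ?_)
    have hc : Continuous fun z : V3 × V3 => cutoff n z.1 * cutEnergy n z.2 :=
      ((contDiff_cutoff n).continuous.comp continuous_fst).mul
        ((contDiff_cutEnergy n).continuous.comp continuous_snd)
    exact hc.const_mul (θ 0)
  · refine Filter.Eventually.of_forall fun z => ?_
    simp only [energyTest, norm_mul, Real.norm_of_nonneg (energy_pos z.2).le,
      Real.norm_of_nonneg (cutoff_nonneg n z.1), Real.norm_of_nonneg (cutEnergy_nonneg n z.2),
      Real.norm_eq_abs]
    calc |f₀ z| * (|θ 0| * (cutoff n z.1 * cutEnergy n z.2))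
        ≤ |f₀ z| * (|θ 0| * (1 * energy z.2)) := by
          gcongr
          · exact cutEnergy_nonneg _ _
          · exact cutoff_le_one _ _
          · exact cutEnergy_le _ _
      _ = _ := by ring
  · refine Filter.Eventually.of_forall fun z => ?_
    obtain ⟨N, hN⟩ := exists_nat_gt (max ‖z.1‖ ‖z.2‖)
    refine tendsto_const_nhds.congr' ?_
    filter_upwards [Filter.eventually_ge_atTop N] with n hn
    have hn' : (N : ℝ) ≤ n := by exact_mod_cast hn
    have hx : ‖z.1‖ ≤ n + 1 := by linarith [le_max_left ‖z.1‖ ‖z.2‖]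
    have hp : ‖z.2‖ ≤ n + 1 := by linarith [le_max_right ‖z.1‖ ‖z.2‖]
    simp only [energyTest, cutoff_eq_one hx, cutEnergy_of_le hp]
    ring

/-- The energy balance in weak form. -/
lemma weak_energy_balance {f₀ : V3 × V3 → ℝ} (hf₀ : MemL1Kin f₀) (hf : MemLinftyKin T f)
    (hE : MemLinftyL2 T E) (hB : MemLinftyL2 T B) (hV : VlasovWeak T f₀ f E B)
    (hEf : Integrable (fun z : ℝ × V3 × V3 => ‖E z.1 z.2.1‖ * f z.1 z.2)
      ((volume.restrict (Ioo 0 T)).prod volume))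
    (hBf : Integrable (fun z : ℝ × V3 × V3 => ‖B z.1 z.2.1‖ * f z.1 z.2)
      ((volume.restrict (Ioo 0 T)).prod volume))
    {θ : ℝ → ℝ} (hθ : ContDiff ℝ ∞ θ) (hθc : HasCompactSupport θ) (hθT : tsupport θ ⊆ Iio T) :
    ∫ t in Ioo 0 T, (deriv θ t * (∫ z : V3 × V3, energy z.2 * f t z)
        + θ t * ∫ x, inner ℝ (E t x) (current f t x))
      = -(θ 0 * ∫ z : V3 × V3, energy z.2 * f₀ z) := by
  have hW := integrable_power hf hE hEf
  have hεf := hf.integrable_energy_mul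
  obtain ⟨M, hM⟩ := exists_vlasovIntegrand_bound hθ hθc
  have hbound := ((hεf.norm.add hEf.norm).add hBf.norm).const_mul M
  have hmeas := aestronglyMeasurable_vlasovIntegrand hf hE hB hθ hθc hθT
  have hle : ∀ n, ∀ᵐ z ∂((volume.restrict (Ioo 0 T)).prod volume),
      ‖vlasovIntegrand f E B θ n z‖ ≤ _ := fun n =>
    Filter.Eventually.of_forall (hM f E B n)
  have hlim := tendsto_integral_of_dominated_convergence _ hmeas hbound hle
    (Filter.Eventually.of_forall (tendsto_vlasovIntegrand hθ))
  have heq : ∀ n, ∫ z, vlasovIntegrand f E B θ n z ∂((volume.restrict (Ioo 0 T)).prod volume)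
      = - ∫ z : V3 × V3, f₀ z * energyTest θ n (0, z) := fun n => by
    -- The weak formulation uses iterated integrals; domination gives the joint integrability that
    -- Fubini needs.
    rw [integral_prod _ (hbound.mono' (hmeas n) (hle n))]
    exact hV _ (isTest_energyTest hθ hθc hθT n)
  simp_rw [heq] at hlim
  have hfinal := tendsto_nhds_unique hlim (tendsto_initial hf₀ θ).neg
  rw [← hfinal]
  obtain ⟨a, ha⟩ := hθ.continuous.bounded_above_of_compact_support hθc
  obtain ⟨b, hb⟩ := (hθ.continuous_deriv (by simp)).bounded_above_of_compact_support hθc.deriv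
  have i1 : Integrable (fun z : ℝ × V3 × V3 => deriv θ z.1 * (energy z.2.2 * f z.1 z.2))
      ((volume.restrict (Ioo 0 T)).prod volume) :=
    hεf.bdd_mul ((hθ.continuous_deriv (by simp)).comp continuous_fst).aestronglyMeasurable
      (Filter.Eventually.of_forall fun z => hb z.1)
  have i2 : Integrable (fun z : ℝ × V3 × V3 =>
      θ z.1 * (f z.1 z.2 * inner ℝ (E z.1 z.2.1) (vel z.2.2)))
      ((volume.restrict (Ioo 0 T)).prod volume) :=
    hW.bdd_mul (hθ.continuous.comp continuous_fst).aestronglyMeasurable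
      (Filter.Eventually.of_forall fun z => ha z.1)
  rw [integral_prod (fun z : ℝ × V3 × V3 => deriv θ z.1 * (energy z.2.2 * f z.1 z.2)
    + θ z.1 * (f z.1 z.2 * inner ℝ (E z.1 z.2.1) (vel z.2.2))) (i1.add i2)]
  refine integral_congr_ae ?_
  filter_upwards [i1.prod_right_ae, i2.prod_right_ae, ae_integral_power_eq hf hW] with t h1 h2 h3
  rw [integral_add h1 h2, integral_const_mul, integral_const_mul, h3]

end

end RVM

theorem lemma3 (T lam : ℝ) (hT : 0 < T) (hlam : 0 < lam)
    (f₀ : RVM.V3 × RVM.V3 → ℝ) (E₀ B₀ : RVM.V3 → RVM.V3)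
    (hf₀ : RVM.MemL1Kin f₀) (hf₀_bdd : MemLp f₀ ⊤) (hE₀ : MemLp E₀ 2) (hB₀ : MemLp B₀ 2)
    (f : ℝ → RVM.V3 × RVM.V3 → ℝ) (E B : ℝ → RVM.V3 → RVM.V3)
    (hsol : RVM.IsWeakSolution T f₀ E₀ B₀ f E B)
    (hE : ∀ i : Fin 3, RVM.MemL1BVLoc T (fun t x => E t x i))
    (hB : ∀ i : Fin 3, RVM.MemL1BVLoc T (fun t x => B t x i))
    (hrho : ∃ C : ℝ≥0, ∀ᵐ t ∂(volume.restrict (Ioo 0 T)),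
      eLpNorm (RVM.rhoMoment lam f t) 2 volume ≤ C) :
    Integrable (fun z : ℝ × RVM.V3 => inner ℝ (E z.1 z.2) (RVM.current f z.1 z.2))
        ((volume.restrict (Ioo 0 T)).prod volume) ∧
      ∀ᵐ t ∂(volume.restrict (Ico 0 T)),
        ∫ z : RVM.V3 × RVM.V3, RVM.energy z.2 * f t z
          = (∫ z : RVM.V3 × RVM.V3, RVM.energy z.2 * f₀ z)
            + ∫ s in (0 : ℝ)..t, ∫ x : RVM.V3, inner ℝ (E s x) (RVM.current f s x) := by
  have hEf := RVM.integrable_field_mul hlam hsol.f_mem hsol.E_mem hrho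
  have hBf := RVM.integrable_field_mul hlam hsol.f_mem hsol.B_mem hrho
  have hEj := RVM.integrable_inner_current hsol.f_mem
    (RVM.integrable_power hsol.f_mem hsol.E_mem hEf)
  refine ⟨hEj, ?_⟩
  -- The time `0` is a null set.
  rw [← restrict_Ioo_eq_restrict_Ico]
  exact RVM.ae_eq_add_integral_of_weak_deriv hT
    hsol.f_mem.integrable_energy_mul.integral_prod_left hEj.integral_prod_left
    fun θ hθ hθc hθT => RVM.weak_energy_balance hf₀ hsol.f_mem hsol.E_mem hsol.B_mem hsol.vlasov
      hEf hBf hθ hθc hθT
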